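/- Let $\mathbf T$ be a countable homogeneous tournament, that is (up to isomorphism) one of $I_1$, $C_3$, $\mathbb Q$, $\mathbf S(2)$, $T^\omega$, and let $\mathbf T^*$ be its expansion in a language consisting of the edge symbol $E$, a symbol $<$ and finitely many unary predicates: - $I_1^*$: one point, with one unary predicate holding at it ($E$ and $<$ are empty); - $C_3^*$: the directed $3$-cycle with three unary predicates, one for each point, and a linear order $<$; - $\mathbb Q^*$: the rationals, where both $E$ and $<$ are the usual order; - $\mathbf S(2)^*$: the points of the unit circle at rational angle (in radians), with $E(x,y)$ iff the angle from $x$ to $y$ lies in $(0,\pi)$, two unary predicates for the left and the right half of the circle, and the linear order $<$ that is obtained from $E$ by reversing the edges between points in different halves; - $T^{\omega *}$: the Fraïssé limit of the class of finite linearly ordered tournaments. Let $\prec$ be a dense linear order on $\mathbb N$, and let $I_\omega[\mathbf T]^*$ be the structure with universe $\mathbb N\times T$ in which $E((i,x),(j,y))$ iff $i=j$ and $E^{\mathbf T}(x,y)$; $P((i,x))$ iff $P^{\mathbf T^*}(x)$, for each unary predicate $P$; and $(i,x)<(j,y)$ iff $i\prec j$, or $i=j$ and $x<^{\mathbf T^*}y$.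 Then the class $\mathrm{Age}(I_\omega[\mathbf T]^*)$ of the finite structures that embed in $I_\omega[\mathbf T]^*$ has the Ramsey property: for every $k\in\mathbb N$ and all $\mathbf A,\mathbf B\in \mathrm{Age}(I_\omega[\mathbf T]^*)$ there is $\mathbf C\in\mathrm{Age}(I_\omega[\mathbf T]^*)$ such that for every colouring with $k$ colours of the substructures of $\mathbf C$ isomorphic to $\mathbf A$, there is a substructure $\mathbf B'$ of $\mathbf C$ isomorphic to $\mathbf B$ such that all substructures of $\mathbf B'$ isomorphic to $\mathbf A$ have the same colour. -/

import Mathlib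

open FirstOrder FirstOrder.Language CategoryTheory

universe u v w

/-! ### Copies, arrows and the Ramsey property -/

/-- The set of copies of `A` in `C`: the substructures of `C` isomorphic to `A`. -/
def copies (L : FirstOrder.Language.{u, v}) (C A : Type w) [L.Structure C] [L.Structure A] :
    Set (L.Substructure C) :=
  {S | Nonempty (S ≃[L] A)}

/-- The partition relation `C ⟶ (B)^A_{k,l}`: for every colouring `c` of the copies of `A` in `C`
with `k` colours there is a copy `B'` of `B` in `C` such that `c` takes at most `l` values on the
copies of `A` that lie in `B'`. -/
def Arrows (L : FirstOrder.Language.{u, v}) (C B A : Type w) [L.Structure C] [L.Structure B] [L.Structure A]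
    (k l : ℕ) : Prop :=
  ∀ c : copies L C A → Fin k, ∃ B' ∈ copies L C B,
    (c '' {A' : copies L C A | (A' : L.Substructure C) ≤ B'}).ncard ≤ l

/-- The Ramsey property of a class of structures. -/
def RamseyProperty (L : FirstOrder.Language.{u, v}) (K : Set (Bundled.{w} L.Structure)) : Prop :=
  ∀ k : ℕ, ∀ A ∈ K, ∀ B ∈ K, ∃ C ∈ K, Arrows L C B A k 1

/-! ### The languages of the expanded tournaments -/

/-- Relation symbols: a directed edge, a linear order, and `n` unary predicates. -/
inductive ExpRel (n : ℕ) : ℕ → Type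
  | edge : ExpRel n 2
  | lt : ExpRel n 2
  | part (i : Fin n) : ExpRel n 1

/-- The relational language `{E, <, P₀, …, P₍ₙ₋₁₎}`. -/
def expLang (n : ℕ) : FirstOrder.Language.{0, 0} := ⟨fun _ => Empty, ExpRel n⟩

instance expLang_isRelational (n : ℕ) : (expLang n).IsRelational :=
  fun _ => inferInstanceAs (IsEmpty Empty)

/-- The `expLang n`-structure on `M` with the given interpretations of the symbols. -/
@[reducible] def mkExp {n : ℕ} {M : Type w} (E lt : M → M → Prop) (P : Fin n → M → Prop) :
    (expLang n).Structure M where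
  funMap := fun f => f.elim
  RelMap := fun R =>
    match R with
    | .edge => fun x => E (x 0) (x 1)
    | .lt => fun x => lt (x 0) (x 1)
    | .part i => fun x => P i (x 0)

section
variable (n : ℕ) {M : Type w} [(expLang n).Structure M]

/-- The directed edge relation of an `expLang n`-structure. -/
def edgeRel (x y : M) : Prop :=
  Structure.RelMap (L := expLang n) (ExpRel.edge : (expLang n).Relations 2) ![x, y]

/-- The distinguished order relation of an `expLang n`-structure. -/
def ltRel (x y : M) : Prop :=
  Structure.RelMap (L := expLang n) (ExpRel.lt : (expLang n).Relations 2) ![x, y]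

/-- The `i`-th unary predicate of an `expLang n`-structure. -/
def partRel (i : Fin n) (x : M) : Prop :=
  Structure.RelMap (L := expLang n) (ExpRel.part i : (expLang n).Relations 1) ![x]

end

/-! ### The homogeneous tournaments `T` with their expansions `T*` -/

/-- `I₁*`: one point, no edge, one unary predicate holding at the point. -/
def OneVertex : Type := Unit

instance oneVertexStar : (expLang 1).Structure OneVertex :=
  mkExp (fun _ _ => False) (fun _ _ => False) (fun _ _ => True)

/-- The universe `{0, 1, 2}` of `C₃*`, which is ordered by `r`. -/
def ThreeCycle (_r : Fin 3 → Fin 3 → Prop) : Type := Fin 3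

/-- `C₃*`: the directed cycle `0 → 1 → 2 → 0`, with one unary predicate for each point and with the
linear order `r`. -/
instance threeCycleStar (r : Fin 3 → Fin 3 → Prop) : (expLang 3).Structure (ThreeCycle r) :=
  mkExp (M := Fin 3) (fun x y => y = x + 1) r (fun i x => x = i)

/-- `ℚ* = ℚ`: both the edge relation and the distinguished order are the usual `<`. -/
instance rationalStar : (expLang 0).Structure ℚ :=
  mkExp (fun x y => x < y) (fun x y => x < y) (fun i _ => i.elim0)

/-- The points of the dense local order `S(2)`: the points of the unit circle at a rational angle
(in radians, so that no two of them are antipodal and none is at `± π / 2`). -/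
abbrev LocalOrder : Type := {θ : Real.Angle // ∃ q : ℚ, θ = ((q : ℝ) : Real.Angle)}

/-- There is an edge of `S(2)` from `x` to `y` iff the angle from `x` to `y` is in `(0, π)`. -/
def LocalOrder.edge (x y : LocalOrder) : Prop :=
  0 < (y.1 - x.1).toReal ∧ (y.1 - x.1).toReal < Real.pi

/-- The point lies in the right half of the circle. -/
def LocalOrder.right (x : LocalOrder) : Prop := 0 < x.1.cos

/-- The linear order of `S(2)*`: the edge relation, reversed between the two halves. -/
def LocalOrder.lt (x y : LocalOrder) : Prop :=
  ((x.right ↔ y.right) ∧ x.edge y) ∨ (¬(x.right ↔ y.right) ∧ y.edge x)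

/-- `S(2)*`: `S(2)` with two unary predicates for the left half and the right half, and with its
linear order. -/
instance localOrderStar : (expLang 2).Structure LocalOrder :=
  mkExp LocalOrder.edge LocalOrder.lt ![fun x => x.1.cos < 0, fun x => 0 < x.1.cos]

/-- The class of finite linearly ordered tournaments. -/
def finiteOrderedTournaments : Set (Bundled.{w} (expLang 0).Structure) :=
  {M | Finite M ∧
    (∀ x y : M, edgeRel 0 x y → ¬ edgeRel 0 y x) ∧
    (∀ x y : M, x ≠ y → edgeRel 0 x y ∨ edgeRel 0 y x) ∧
    IsStrictTotalOrder M (ltRel 0)}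

/-- `T` is, up to isomorphism, the expansion `T*` of one of the countable homogeneous tournaments
`I₁`, `C₃`, `ℚ`, `S(2)`, `T^ω`.  The generic tournament `T^ω` with a generic linear order is the
Fraïssé limit of the finite linearly ordered tournaments. -/
inductive IsExpandedHomogeneousTournament :
    (n : ℕ) → (T : Type w) → [(expLang n).Structure T] → Prop
  | point (T : Type w) [(expLang 1).Structure T] (h : Nonempty (T ≃[expLang 1] OneVertex)) :
      IsExpandedHomogeneousTournament 1 T
  | cycle (T : Type w) [(expLang 3).Structure T] (r : Fin 3 → Fin 3 → Prop)
      (hr : IsStrictTotalOrder (Fin 3) r) (h : Nonempty (T ≃[expLang 3] ThreeCycle r)) :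
      IsExpandedHomogeneousTournament 3 T
  | rational (T : Type w) [(expLang 0).Structure T] (h : Nonempty (T ≃[expLang 0] ℚ)) :
      IsExpandedHomogeneousTournament 0 T
  | localOrder (T : Type w) [(expLang 2).Structure T]
      (h : Nonempty (T ≃[expLang 2] LocalOrder)) :
      IsExpandedHomogeneousTournament 2 T
  | generic (T : Type w) [(expLang 0).Structure T] [Countable T]
      (h : IsFraisseLimit finiteOrderedTournaments.{w} T) :
      IsExpandedHomogeneousTournament 0 T

/-! ### The structure `I_ω[T]*` -/

/-- The universe `ℕ × T` of `I_ω[T]*`; the set `ℕ` of parts is ordered by `prec`. -/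
def IOmega (_prec : ℕ → ℕ → Prop) (T : Type w) : Type w := ℕ × T

/-- `I_ω[T]*`: edges only within a part and as in `T`, unary predicates as in `T*`, and the
lexicographic product of `prec` with the order of `T*`. -/
instance iOmegaStar (n : ℕ) (prec : ℕ → ℕ → Prop) (T : Type w) [(expLang n).Structure T] :
    (expLang n).Structure (IOmega prec T) :=
  mkExp (M := ℕ × T)
    (fun x y => x.1 = y.1 ∧ edgeRel n x.2 y.2)
    (fun x y => prec x.1 y.1 ∨ (x.1 = y.1 ∧ ltRel n x.2 y.2))
    (fun i x => partRel n i x.2)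

/-! ### Ramsey's theorem -/

/-! It suffices to colour embeddings instead of copies (`EmbArrows.arrows`). The proof establishes
this stronger Ramsey property for the age of each `T*` and then transfers it to the lexicographic
product.

For `I₁*` and `C₃*` the predicates name the points, so there is at most one embedding between two
members of the age. The structures `ℚ` and `S(2)*` are coded by a linear order whose points carry
labels (for `S(2)*`, the half of the circle, with the points ordered by slope), so Ramsey's theorem
applies to them. For `T^ω*` the age is the class of finite ordered tournaments. Here the partite
construction is used: Ramsey's theorem fixes the set of parts, and for each position of `A` among
the parts the Hales–Jewett theorem makes the colour of the copies of `A` constant.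

For the product, `T` is a tournament, so two points lie in the same part iff they are equal or
joined by an edge. An embedding therefore amounts to an order embedding of the parts together with
embeddings between corresponding parts. A product Ramsey theorem (`HasEmbRamsey.exists_pi_forall`)
makes the colour depend only on the placement of the parts, and Ramsey's theorem for linear orders
removes that dependence (`HasEmbRamsey.exists_embArrows`). -/

/-- Ramsey's theorem for finite hypergraphs, with a size requirement for each colour. -/
theorem exists_card_forall_exists_monochromatic {κ : Type v} [Finite κ] (r : ℕ) (m : κ → ℕ) :
    ∃ N : ℕ, ∀ (α : Type) [DecidableEq α] (X : Finset α), N ≤ X.card → ∀ χ : Finset α → κ,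
      ∃ c, ∃ Y ⊆ X, m c ≤ Y.card ∧ ∀ s ⊆ Y, s.card = r → χ s = c := by
  classical
  have := Fintype.ofFinite κ
  induction r generalizing m with
  | zero =>
    refine ⟨∑ c, m c, fun α _ X hX χ => ⟨χ ∅, X, subset_rfl, ?_, ?_⟩⟩
    · exact (Finset.single_le_sum (fun _ _ => Nat.zero_le _) (Finset.mem_univ (χ ∅))).trans hX
    · intro s _ hs
      rw [Finset.card_eq_zero.1 hs]
  | succ r ih =>
    induction hS : ∑ c, m c using Nat.strong_induction_on generalizing m with
    | _ S ihS =>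
    by_cases h0 : ∃ c, m c = 0
    · obtain ⟨c, hc⟩ := h0
      refine ⟨0, fun α _ X _ χ => ⟨c, ∅, Finset.empty_subset _, by simp [hc], ?_⟩⟩
      intro s hs hr
      simp [Finset.subset_empty.1 hs] at hr
    · push Not at h0
      -- As in the Erdős–Szekeres recursion: `R c` suffices when the requirement for `c` alone is
      -- lowered by one, since a further vertex will be available for that colour.
      have hR : ∀ c, ∃ N : ℕ, ∀ (α : Type) [DecidableEq α] (X : Finset α), N ≤ X.card →
          ∀ χ : Finset α → κ, ∃ c', ∃ Y ⊆ X, Function.update m c (m c - 1) c' ≤ Y.card ∧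
            ∀ s ⊆ Y, s.card = r + 1 → χ s = c' := by
        intro c
        refine ihS _ ?_ _ rfl
        rw [← hS]
        refine Finset.sum_lt_sum (fun i _ => ?_) ⟨c, Finset.mem_univ c, ?_⟩
        · by_cases hi : i = c
          · subst hi; simp
          · simp [hi]
        · have := h0 c
          simp; omega
      choose R hR using hR
      obtain ⟨N, hN⟩ := ih R
      refine ⟨N + 1, fun α _ X hX χ => ?_⟩
      obtain ⟨x, hx⟩ : X.Nonempty := Finset.card_pos.1 (by omega)
      -- The `r`-sets are coloured through the link of `x`. If the colour found inside `Y` is again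
      -- `c`, then `x` can be added to the set.
      obtain ⟨c, Y, hYX, hY, hYc⟩ := hN α (X.erase x) (by rw [Finset.card_erase_of_mem hx]; omega)
        (fun s => χ (insert x s))
      obtain ⟨c', Z, hZY, hZ, hZc⟩ := hR c α Y hY χ
      have hZX : Z ⊆ X := hZY.trans (hYX.trans (Finset.erase_subset _ _))
      by_cases hcc : c' = c
      · subst hcc
        have hxZ : x ∉ Z := fun h => by simpa using hYX (hZY h)
        refine ⟨c', insert x Z, Finset.insert_subset hx hZX, ?_, ?_⟩
        · rw [Finset.card_insert_of_notMem hxZ]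
          simp at hZ; omega
        · intro s hs hr
          by_cases hxs : x ∈ s
          · rw [← Finset.insert_erase hxs]
            refine hYc _ ?_ (by rw [Finset.card_erase_of_mem hxs]; omega)
            exact (Finset.subset_insert_iff.1 hs).trans hZY
          · exact hZc s ((Finset.subset_insert_iff_of_notMem hxs).1 hs) hr
      · refine ⟨c', Z, hZX, ?_, hZc⟩
        simpa [hcc] using hZ

/-- Ramsey's theorem for colourings of the embeddings between finite linear orders. -/
theorem exists_orderEmbedding_monochromatic (A : Type u) (B : Type w) [LinearOrder A] [Finite A]
    [LinearOrder B] [Finite B] (κ : Type v) [Finite κ] :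
    ∃ N : ℕ, ∀ χ : (A ↪o Fin N) → κ, ∃ F : B ↪o Fin N, ∀ e e' : A ↪o B,
      χ (e.trans F) = χ (e'.trans F) := by
  classical
  have := Fintype.ofFinite A
  have := Fintype.ofFinite B
  obtain ⟨N, hN⟩ := exists_card_forall_exists_monochromatic (κ := Option κ) (Fintype.card A)
    (fun _ => Fintype.card B)
  refine ⟨N, fun χ => ?_⟩
  obtain ⟨c, Y, -, hY, hc⟩ := hN (Fin N) Finset.univ (by simp) fun s =>
    -- An order embedding is determined by its range. The default `none` is never the colour of the
    -- range of an embedding of `A`.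
    if h : ∃ e : A ↪o Fin N, Set.range e = s then some (χ h.choose) else none
  let F : B ↪o Fin N :=
    (Fintype.orderIsoFinOfCardEq B rfl).symm.toOrderEmbedding.trans (Y.orderEmbOfCardLe hY)
  have key : ∀ e : A ↪o B, some (χ (e.trans F)) = c := by
    intro e
    rw [← hc (Finset.univ.map (e.trans F).toEmbedding) ?_ (by simp)]
    · have h : ∃ e' : A ↪o Fin N,
          Set.range e' = ↑(Finset.univ.map (e.trans F).toEmbedding) := ⟨e.trans F, by simp⟩
      rw [dif_pos h]
      have h2 := h.choose_spec
      congr 2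
      refine (OrderEmbedding.range_inj.1 ?_).symm
      rw [h2]; simp
    · intro y hy
      simp only [Finset.mem_map, Finset.mem_univ, true_and] at hy
      obtain ⟨a, rfl⟩ := hy
      exact Y.orderEmbOfCardLe_mem hY _
  exact ⟨F, fun e e' => Option.some_injective _ ((key e).trans (key e').symm)⟩

/-! ### Partite systems and the partite construction -/

/-- A finite set partitioned into parts that are indexed by `P`, with a binary relation that is
relevant only for pairs of points in increasing parts. -/
structure PartiteSystem (P : Type) where
  /-- The underlying set. -/
  V : Type u
  /-- The part of a point. -/
  proj : V → P
  /-- The relation. -/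
  rel : V → V → Prop
  finite : Finite V

namespace PartiteSystem

variable {P : Type} [LinearOrder P]

/-- Maps that preserve the parts and the relation on pairs in increasing parts. -/
structure Hom (V W : PartiteSystem.{u} P) where
  /-- The underlying map. -/
  toFun : V.V → W.V
  proj_toFun : ∀ v, W.proj (toFun v) = V.proj v
  rel_toFun : ∀ v v', V.proj v < V.proj v' → (W.rel (toFun v) (toFun v') ↔ V.rel v v')

/-- Composition of maps of partite systems. -/
def Hom.comp {U V W : PartiteSystem.{u} P} (f : Hom V W) (g : Hom U V) : Hom U W where
  toFun := f.toFun ∘ g.toFun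
  proj_toFun v := by simp [f.proj_toFun, g.proj_toFun]
  rel_toFun v v' h := by
    simp only [Function.comp_apply]
    rw [f.rel_toFun _ _ (by rwa [g.proj_toFun, g.proj_toFun]), g.rel_toFun _ _ h]

/-- The copies of `(A, <, R)` in a partite system with one point in each part in the range
of `e`. -/
@[ext] structure Transversal {A : Type u} [LinearOrder A] (R : A → A → Prop) (e : A ↪o P)
    (V : PartiteSystem.{u} P) where
  /-- The underlying map. -/
  toFun : A → V.V
  proj_toFun : ∀ i, V.proj (toFun i) = e i
  rel_toFun : ∀ i j, i < j → (V.rel (toFun i) (toFun j) ↔ R i j)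

variable {A : Type u} [LinearOrder A] {R : A → A → Prop} {e : A ↪o P}

/-- The image of a copy of `A`. -/
def Transversal.map {V W : PartiteSystem.{u} P} (g : Transversal R e V) (f : Hom V W) :
    Transversal R e W where
  toFun := f.toFun ∘ g.toFun
  proj_toFun i := by simp [f.proj_toFun, g.proj_toFun]
  rel_toFun i j h := by
    simp only [Function.comp_apply]
    rw [f.rel_toFun _ _ (by rw [g.proj_toFun, g.proj_toFun]; exact e.strictMono h),
      g.rel_toFun _ _ h]

instance [Finite A] (V : PartiteSystem.{u} P) : Finite (Transversal R e V) := by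
  have := V.finite
  exact Finite.of_injective Transversal.toFun fun _ _ => Transversal.ext

section power
variable (R e) (V : PartiteSystem.{u} P) (ι : Type)

/-- The point of the partite power over the point `u` of `V` in the part `e i`. -/
def linePoint (l : ι → Option (Transversal R e V)) (i : A) (u : V.V) : ι → V.V :=
  fun t => (l t).elim u (fun g => g.toFun i)

/-- The amalgam of copies of `V`, one for each word `l`, over the power of the part of `V` that
lies over the range of `e`. -/
abbrev power [Finite A] [Finite ι] : PartiteSystem.{u} P where
  V := (A × (ι → V.V)) ⊕ ((ι → Option (Transversal R e V)) × V.V)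
  proj := Sum.elim (fun x => e x.1) (fun y => V.proj y.2)
  rel
    | .inl x, .inl y =>
      -- On a line, the constant coordinates have the truth value of `R`. A conjunction when `R`
      -- holds and a disjunction when it fails ignore these coordinates and return the value at the
      -- variable ones.
      (R x.1 y.1 ∧ ∀ t, V.rel (x.2 t) (y.2 t)) ∨ (¬ R x.1 y.1 ∧ ∃ t, V.rel (x.2 t) (y.2 t))
    | .inl x, .inr y =>
      ∃ u, V.proj u = e x.1 ∧ x.2 = linePoint R e V ι y.1 x.1 u ∧ V.rel u y.2
    | .inr x, .inl y =>
      ∃ u, V.proj u = e y.1 ∧ y.2 = linePoint R e V ι x.1 y.1 u ∧ V.rel x.2 u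
    | .inr x, .inr y => V.rel x.2 y.2
  finite := by
    have := V.finite
    infer_instance

variable {V ι}

/-- The product of copies of `A` is a copy of `A` in the partite power. -/
def wordTransversal [Finite A] [Finite ι] (w : ι → Transversal R e V) :
    Transversal R e (power R e V ι) where
  toFun i := .inl (i, fun t => (w t).toFun i)
  proj_toFun i := rfl
  rel_toFun i j h := by
    change ((R i j ∧ ∀ t, V.rel ((w t).toFun i) ((w t).toFun j)) ∨
      (¬ R i j ∧ ∃ t, V.rel ((w t).toFun i) ((w t).toFun j))) ↔ R i j
    simp only [(w _).rel_toFun i j h]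
    by_cases hR : R i j <;> simp [hR]

open Classical in
/-- The embedding of `V` into its partite power given by a word. -/
noncomputable def lineMap (l : ι → Option (Transversal R e V)) (v : V.V) :
    (A × (ι → V.V)) ⊕ ((ι → Option (Transversal R e V)) × V.V) :=
  if h : ∃ i, e i = V.proj v then .inl (h.choose, linePoint R e V ι l h.choose v)
  else .inr (l, v)

theorem lineMap_of_eq (l : ι → Option (Transversal R e V)) {v : V.V} {i : A}
    (h : e i = V.proj v) : lineMap R e l v = .inl (i, linePoint R e V ι l i v) := by
  have h' : ∃ i, e i = V.proj v := ⟨i, h⟩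
  have hi : h'.choose = i := e.injective (h'.choose_spec.trans h.symm)
  rw [lineMap, dif_pos h', hi]

theorem lineMap_of_forall_ne (l : ι → Option (Transversal R e V)) {v : V.V}
    (h : ¬ ∃ i, e i = V.proj v) : lineMap R e l v = .inr (l, v) :=
  dif_neg h

/-- The embedding of `V` into its partite power given by a combinatorial line. -/
noncomputable def lineHom [Finite A] [Finite ι]
    (l : Combinatorics.Line (Transversal R e V) ι) : Hom V (power R e V ι) where
  toFun := lineMap R e l.idxFun
  proj_toFun v := by
    by_cases h : ∃ i, e i = V.proj v
    · obtain ⟨i, hi⟩ := h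
      rw [lineMap_of_eq R e _ hi]
      exact hi
    · rw [lineMap_of_forall_ne R e _ h]
      rfl
  rel_toFun v v' hlt := by
    -- At a variable coordinate the point of `V` itself can be read off.
    obtain ⟨t₀, ht₀⟩ := l.proper
    have inj : ∀ i u u', linePoint R e V ι l.idxFun i u = linePoint R e V ι l.idxFun i u' →
        u = u' := by
      intro i u u' h
      simpa [linePoint, ht₀] using congrFun h t₀
    by_cases h : ∃ i, e i = V.proj v <;> by_cases h' : ∃ i, e i = V.proj v'
    · obtain ⟨i, hi⟩ := h
      obtain ⟨j, hj⟩ := h'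
      rw [lineMap_of_eq R e _ hi, lineMap_of_eq R e _ hj]
      have hij : i < j := by rw [← e.lt_iff_lt, hi, hj]; exact hlt
      change ((R i j ∧ ∀ t, V.rel (linePoint R e V ι l.idxFun i v t)
          (linePoint R e V ι l.idxFun j v' t)) ∨ (¬ R i j ∧ ∃ t, V.rel
          (linePoint R e V ι l.idxFun i v t) (linePoint R e V ι l.idxFun j v' t))) ↔ V.rel v v'
      have hc : ∀ t, l.idxFun t ≠ none → (V.rel (linePoint R e V ι l.idxFun i v t)
          (linePoint R e V ι l.idxFun j v' t) ↔ R i j) := by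
        intro t ht
        obtain ⟨g, hg⟩ := Option.ne_none_iff_exists'.1 ht
        simp only [linePoint, hg, Option.elim]
        exact g.rel_toFun i j hij
      have hn : ∀ t, l.idxFun t = none → (V.rel (linePoint R e V ι l.idxFun i v t)
          (linePoint R e V ι l.idxFun j v' t) ↔ V.rel v v') := by
        intro t ht
        simp [linePoint, ht]
      by_cases hR : R i j
      · simp only [hR, true_and, not_true_eq_false, false_and, or_false]
        refine ⟨fun H => (hn t₀ ht₀).1 (H t₀), fun H t => ?_⟩
        by_cases ht : l.idxFun t = none
        · exact (hn t ht).2 H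
        · exact (hc t ht).2 hR
      · simp only [hR, false_and, not_false_eq_true, true_and, false_or]
        refine ⟨fun ⟨t, H⟩ => ?_, fun H => ⟨t₀, (hn t₀ ht₀).2 H⟩⟩
        by_cases ht : l.idxFun t = none
        · exact (hn t ht).1 H
        · exact absurd ((hc t ht).1 H) hR
    · obtain ⟨i, hi⟩ := h
      rw [lineMap_of_eq R e _ hi, lineMap_of_forall_ne R e _ h']
      refine ⟨fun ⟨u, _, hu, H⟩ => ?_, fun H => ⟨v, hi.symm, rfl, H⟩⟩
      rwa [inj _ _ _ hu]
    · obtain ⟨j, hj⟩ := h'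
      rw [lineMap_of_forall_ne R e _ h, lineMap_of_eq R e _ hj]
      refine ⟨fun ⟨u, _, hu, H⟩ => ?_, fun H => ⟨v', hj.symm, rfl, H⟩⟩
      rwa [inj _ _ _ hu]
    · rw [lineMap_of_forall_ne R e _ h, lineMap_of_forall_ne R e _ h']

/-- Constant coordinates do not see `g`, and variable ones reproduce it. So the copies of `A`
carried over by the line map are the points of the combinatorial line, and a monochromatic line
gives a monochromatic copy of `V`. -/
theorem map_lineHom [Finite A] [Finite ι]
    (l : Combinatorics.Line (Transversal R e V) ι) (g : Transversal R e V) :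
    g.map (lineHom R e l) = wordTransversal R e (l g) := by
  refine Transversal.ext (funext fun i => ?_)
  refine (lineMap_of_eq R e _ (g.proj_toFun i).symm).trans ?_
  refine congrArg Sum.inl (Prod.ext rfl (funext fun t => ?_))
  simp only [linePoint, Combinatorics.Line.coe_apply]
  cases l.idxFun t <;> rfl

end power

/-- The partite lemma, amalgamated. -/
theorem exists_hom_monochromatic [Finite A] (R : A → A → Prop) (e : A ↪o P)
    (V : PartiteSystem.{u} P) (κ : Type v) [Finite κ] :
    ∃ W : PartiteSystem.{u} P, ∀ χ : Transversal R e W → κ, ∃ f : Hom V W,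
      ∀ g g' : Transversal R e V, χ (g.map f) = χ (g'.map f) := by
  obtain ⟨ι, _, hι⟩ := Combinatorics.Line.exists_mono_in_high_dimension (Transversal R e V) κ
  refine ⟨power R e V ι, fun χ => ?_⟩
  obtain ⟨l, c, hl⟩ := hι fun w => χ (wordTransversal R e w)
  refine ⟨lineHom R e l, fun g g' => ?_⟩
  rw [map_lineHom, map_lineHom]
  exact (hl g).trans (hl g').symm

/-- The partite construction: one system for all the positions `e` of the copies. -/
theorem exists_hom_forall_monochromatic [Finite A] [Finite P] (R : A → A → Prop)
    (V : PartiteSystem.{u} P) (κ : Type v) [Finite κ] :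
    ∃ W : PartiteSystem.{u} P, ∀ χ : (e : A ↪o P) → Transversal R e W → κ, ∃ f : Hom V W,
      ∀ (e : A ↪o P) (g g' : Transversal R e V), χ e (g.map f) = χ e (g'.map f) := by
  classical
  have : Finite (A ↪o P) := Finite.of_injective _ DFunLike.coe_injective
  have := Fintype.ofFinite (A ↪o P)
  suffices H : ∀ Φ : Finset (A ↪o P), ∃ W : PartiteSystem.{u} P,
      ∀ χ : (e : A ↪o P) → Transversal R e W → κ, ∃ f : Hom V W,
        ∀ e ∈ Φ, ∀ g g' : Transversal R e V, χ e (g.map f) = χ e (g'.map f) by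
    simpa using H Finset.univ
  intro Φ
  induction Φ using Finset.induction_on with
  | empty => exact ⟨V, fun χ => ⟨⟨id, fun _ => rfl, fun _ _ _ => Iff.rfl⟩, by simp⟩⟩
  | insert e₀ Φ _ ih =>
    obtain ⟨W₁, h₁⟩ := ih
    obtain ⟨W₂, h₂⟩ := exists_hom_monochromatic R e₀ W₁ κ
    refine ⟨W₂, fun χ => ?_⟩
    obtain ⟨f₂, hf₂⟩ := h₂ (χ e₀)
    obtain ⟨f₁, hf₁⟩ := h₁ fun e g => χ e (g.map f₂)
    -- `f₂` has settled position `e₀` on all of `W₁`, and this persists on the image of `f₁`.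
    refine ⟨f₂.comp f₁, fun e he g g' => ?_⟩
    rcases Finset.mem_insert.1 he with rfl | he
    · exact hf₂ (g.map f₁) (g'.map f₁)
    · exact hf₁ e he g g'

end PartiteSystem

/-! ### Partition relations for embeddings -/

section
variable (L : FirstOrder.Language.{0, 0})

/-- For every colouring of the embeddings of `A` in `C` there is an embedding of `B` in `C` all of
whose restrictions to `A` have the same colour. -/
def EmbArrows (C B A : Type u) [L.Structure C] [L.Structure B] [L.Structure A] (k : ℕ) : Prop :=
  ∀ χ : (A ↪[L] C) → Fin k, ∃ f : B ↪[L] C, ∀ g g' : A ↪[L] B, χ (f.comp g) = χ (f.comp g')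

/-- The Ramsey property for embeddings of the class of the finite structures that embed in `T`. -/
def HasEmbRamsey (T : Type w) [L.Structure T] : Prop :=
  ∀ (k : ℕ) (A B : Type u) [L.Structure A] [L.Structure B] [Finite A] [Finite B],
    Nonempty (A ↪[L] T) → Nonempty (B ↪[L] T) →
    ∃ (C : Type u) (_ : L.Structure C), Finite C ∧ Nonempty (C ↪[L] T) ∧ EmbArrows L C B A k

variable {L}

theorem EmbArrows.of_finite {C B A : Type u} [L.Structure C] [L.Structure B] [L.Structure A]
    {κ : Type v} [Finite κ] (h : EmbArrows L C B A (Nat.card κ)) (χ : (A ↪[L] C) → κ) :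
    ∃ f : B ↪[L] C, ∀ g g' : A ↪[L] B, χ (f.comp g) = χ (f.comp g') := by
  obtain ⟨f, hf⟩ := h fun g => Finite.equivFin κ (χ g)
  exact ⟨f, fun g g' => (Finite.equivFin κ).injective (hf g g')⟩

/-- Colour an embedding by the colour of its range. Every copy of `A` inside the range of `f` is the
range of some `f.comp g`. -/
theorem EmbArrows.arrows {C B A : Type u} [L.Structure C] [L.Structure B] [L.Structure A] {k : ℕ}
    (h : EmbArrows L C B A k) : Arrows L C B A k 1 := by
  intro c
  obtain ⟨f, hf⟩ := h fun g => c ⟨g.toHom.range, ⟨g.equivRange.symm⟩⟩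
  refine ⟨f.toHom.range, ⟨f.equivRange.symm⟩, ?_⟩
  have key : ∀ A' : copies L C A, (A' : L.Substructure C) ≤ f.toHom.range → ∃ g : A ↪[L] B,
      A' = ⟨(f.comp g).toHom.range, ⟨(f.comp g).equivRange.symm⟩⟩ := by
    rintro ⟨S, ⟨e⟩⟩ hS
    refine ⟨f.equivRange.symm.toEmbedding.comp ((Substructure.inclusion hS).comp
      e.symm.toEmbedding), Subtype.ext ?_⟩
    ext x
    have hval : ∀ a : A, f (f.equivRange.symm (Substructure.inclusion hS (e.symm a))) =
        (e.symm a : C) := by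
      intro a
      exact congrArg Subtype.val
        (f.equivRange.apply_symm_apply (Substructure.inclusion hS (e.symm a)))
    constructor
    · intro hx
      refine ⟨e ⟨x, hx⟩, ?_⟩
      refine (hval _).trans ?_
      simp
    · rintro ⟨a, rfl⟩
      have := (e.symm a).2
      rw [← hval a] at this
      exact this
  rw [Set.ncard_le_one_iff]
  rintro _ _ ⟨A₁, h₁, rfl⟩ ⟨A₂, h₂, rfl⟩
  obtain ⟨g₁, rfl⟩ := key A₁ h₁
  obtain ⟨g₂, rfl⟩ := key A₂ h₂
  exact hf g₁ g₂

/-- In a relational language, finitely generated means finite. -/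
theorem HasEmbRamsey.ramseyProperty_age [L.IsRelational] {M : Type u} [L.Structure M]
    (h : HasEmbRamsey.{u} L M) : RamseyProperty L (L.age M) := by
  rintro k A ⟨hA, hAM⟩ B ⟨hB, hBM⟩
  have := hA.finite
  have := hB.finite
  obtain ⟨C, _, hC, hCM, harr⟩ := h k A B hAM hBM
  exact ⟨⟨C, inferInstance⟩, ⟨Structure.FG.of_finite, hCM⟩, harr.arrows⟩

theorem HasEmbRamsey.of_equiv {S : Type v} {T : Type w} [L.Structure S] [L.Structure T]
    (h : HasEmbRamsey.{u} L S) (e : T ≃[L] S) : HasEmbRamsey.{u} L T := by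
  rintro k A B _ _ _ _ ⟨a⟩ ⟨b⟩
  obtain ⟨C, i, hC, ⟨c⟩, hCBA⟩ := h k A B ⟨e.toEmbedding.comp a⟩ ⟨e.toEmbedding.comp b⟩
  exact ⟨C, i, hC, ⟨e.symm.toEmbedding.comp c⟩, hCBA⟩

end

/-! ### Embeddings of expanded tournaments -/

section
variable {n : ℕ} {M : Type v} {N : Type w} [(expLang n).Structure M] [(expLang n).Structure N]

theorem comp_vec_two (f : M → N) (x y : M) : f ∘ ![x, y] = ![f x, f y] := by
  funext i
  fin_cases i <;> rfl

theorem edgeRel_map (f : M ↪[expLang n] N) (x y : M) :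
    edgeRel n (f x) (f y) ↔ edgeRel n x y :=
  (iff_of_eq (congrArg _ (comp_vec_two f x y).symm)).trans (f.map_rel _ _)

theorem ltRel_map (f : M ↪[expLang n] N) (x y : M) : ltRel n (f x) (f y) ↔ ltRel n x y :=
  (iff_of_eq (congrArg _ (comp_vec_two f x y).symm)).trans (f.map_rel _ _)

theorem partRel_map (f : M ↪[expLang n] N) (i : Fin n) (x : M) :
    partRel n i (f x) ↔ partRel n i x :=
  (iff_of_eq (congrArg _ (funext fun j => by fin_cases j; rfl))).trans (f.map_rel _ ![x])

theorem relMap_edge (x : Fin 2 → M) :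
    Structure.RelMap (L := expLang n) (ExpRel.edge : (expLang n).Relations 2) x ↔
      edgeRel n (x 0) (x 1) :=
  iff_of_eq (congrArg _ (funext fun j => by fin_cases j <;> rfl))

theorem relMap_lt (x : Fin 2 → M) :
    Structure.RelMap (L := expLang n) (ExpRel.lt : (expLang n).Relations 2) x ↔
      ltRel n (x 0) (x 1) :=
  iff_of_eq (congrArg _ (funext fun j => by fin_cases j <;> rfl))

theorem relMap_part (i : Fin n) (x : Fin 1 → M) :
    Structure.RelMap (L := expLang n) (ExpRel.part i : (expLang n).Relations 1) x ↔
      partRel n i (x 0) :=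
  iff_of_eq (congrArg _ (funext fun j => by fin_cases j; rfl))

/-- An injective map that respects the relations is an embedding. -/
def expEmbedding (f : M → N) (hf : Function.Injective f)
    (hE : ∀ x y, edgeRel n (f x) (f y) ↔ edgeRel n x y)
    (hlt : ∀ x y, ltRel n (f x) (f y) ↔ ltRel n x y)
    (hP : ∀ i x, partRel n i (f x) ↔ partRel n i x) : M ↪[expLang n] N where
  toFun := f
  inj' := hf
  map_fun' := fun f => f.elim
  map_rel' := fun R x => by
    cases R with
    | edge => exact (relMap_edge _).trans ((hE _ _).trans (relMap_edge x).symm)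
    | lt => exact (relMap_lt _).trans ((hlt _ _).trans (relMap_lt x).symm)
    | part i => exact (relMap_part i _).trans ((hP i _).trans (relMap_part i x).symm)

theorem isStrictTotalOrder_ltRel_of_embedding (f : M ↪[expLang n] N)
    (h : IsStrictTotalOrder N (ltRel n)) : IsStrictTotalOrder M (ltRel n) :=
  RelEmbedding.isStrictTotalOrder (s := ltRel n (M := N))
    { toFun := f, inj' := f.injective, map_rel_iff' := ltRel_map f _ _ }

/-- Structures in which the unary predicates separate the points have the Ramsey property, since
there is at most one embedding between two of them. -/
theorem hasEmbRamsey_of_partRel_separates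
    (h : ∀ x y : M, (∀ i, partRel n i x ↔ partRel n i y) → x = y) :
    HasEmbRamsey.{u} (expLang n) M := by
  rintro k A B _ _ _ _ - ⟨b⟩
  refine ⟨B, inferInstance, inferInstance, ⟨b⟩, fun χ => ⟨Embedding.refl _ B, fun g g' => ?_⟩⟩
  congr 2
  ext x
  apply b.injective
  apply h
  intro i
  rw [partRel_map, partRel_map, partRel_map, partRel_map]

end

/-! ### Finite ordered tournaments -/

/-- The finite linearly ordered tournaments have the Ramsey property. -/
theorem exists_embArrows_of_mem_finiteOrderedTournaments (k : ℕ) (A B : Type u)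
    [(expLang 0).Structure A] [(expLang 0).Structure B]
    (hA : (⟨A, inferInstance⟩ : Bundled (expLang 0).Structure) ∈ finiteOrderedTournaments)
    (hB : (⟨B, inferInstance⟩ : Bundled (expLang 0).Structure) ∈ finiteOrderedTournaments) :
    ∃ C ∈ finiteOrderedTournaments.{u}, EmbArrows (expLang 0) C B A k := by
  classical
  obtain ⟨hAf, hAa, hAt, hAo⟩ := hA
  obtain ⟨hBf, hBa, hBt, hBo⟩ := hB
  let : LinearOrder A := linearOrderOfSTO (ltRel 0)
  let : LinearOrder B := linearOrderOfSTO (ltRel 0)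
  change Finite A at hAf
  change Finite B at hBf
  have hltA : ∀ x y : A, ltRel 0 x y ↔ x < y := fun _ _ => Iff.rfl
  have hltB : ∀ x y : B, ltRel 0 x y ↔ x < y := fun _ _ => Iff.rfl
  obtain ⟨N, hN⟩ := exists_orderEmbedding_monochromatic A B (Option (Fin k))
  have : Finite (B ↪o Fin N) := Finite.of_injective _ DFunLike.coe_injective
  -- The initial system is the disjoint union of copies of `B`, one for each placement of `B` among
  -- `N` parts.
  let V : PartiteSystem.{u} (Fin N) :=
    { V := (B ↪o Fin N) × B
      proj := fun x => x.1 x.2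
      rel := fun x y => edgeRel 0 x.2 y.2
      finite := inferInstance }
  obtain ⟨W, hW⟩ := PartiteSystem.exists_hom_forall_monochromatic
    (A := A) (fun x y => edgeRel 0 x y) V (Fin k)
  have := W.finite
  obtain ⟨m, ⟨idx⟩⟩ := Finite.exists_equiv_fin W.V
  let pos : W.V → Fin N ×ₗ Fin m := fun x => toLex (W.proj x, idx x)
  have hpos : Function.Injective pos := by
    intro x y hxy
    have := congrArg (fun z => (ofLex z).2) hxy
    exact idx.injective this
  have hproj : ∀ x y, W.proj x < W.proj y → pos x < pos y := fun x y h =>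
    Prod.Lex.toLex_lt_toLex.2 (Or.inl h)
  -- Complete `W` to an ordered tournament, with points of the same part ordered arbitrarily.
  -- Transversals have their points in distinct parts, so this completion does not affect them.
  let E : W.V → W.V → Prop := fun x y => (pos x < pos y ∧ W.rel x y) ∨ (pos y < pos x ∧ ¬ W.rel y x)
  let : (expLang 0).Structure W.V := mkExp E (fun x y => pos x < pos y) (fun i _ => i.elim0)
  have hE : ∀ x y : W.V, edgeRel 0 x y ↔ E x y := fun _ _ => Iff.rfl
  have hlt : ∀ x y : W.V, ltRel 0 x y ↔ pos x < pos y := fun _ _ => Iff.rfl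
  have hE' : ∀ x y : W.V, pos x < pos y → (edgeRel 0 x y ↔ W.rel x y) := by
    intro x y h
    simp [hE, E, h, h.not_gt]
  have hE'' : ∀ x y : W.V, pos x < pos y → (edgeRel 0 y x ↔ ¬ W.rel x y) := by
    intro x y h
    simp [hE, E, h, h.not_gt]
  have emb : ∀ (D : Type u) [(expLang 0).Structure D] [LinearOrder D]
      (_ : ∀ x y : D, ltRel 0 x y ↔ x < y) (_ : ∀ x y : D, edgeRel 0 x y → ¬ edgeRel 0 y x)
      (_ : ∀ x y : D, x ≠ y → edgeRel 0 x y ∨ edgeRel 0 y x) (p : D → W.V)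
      (_ : ∀ x y, x < y → W.proj (p x) < W.proj (p y))
      (_ : ∀ x y, x < y → (W.rel (p x) (p y) ↔ edgeRel 0 x y)),
      ∃ f : D ↪[expLang 0] W.V, ∀ x, f x = p x := by
    intro D _ _ hD hDa hDt p hp hpE
    have hmono : ∀ x y, x < y → pos (p x) < pos (p y) := fun x y h => hproj _ _ (hp x y h)
    have hsm : StrictMono (fun x => pos (p x)) := hmono
    refine ⟨expEmbedding p (fun x y h => hsm.injective (congrArg pos h)) ?_ ?_
      (fun i => i.elim0), fun _ => rfl⟩
    · intro x y
      rcases lt_trichotomy x y with h | rfl | h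
      · rw [hE' _ _ (hmono _ _ h), hpE _ _ h]
      · have h1 : ¬ edgeRel 0 x x := fun h => hDa _ _ h h
        simp [h1, hE, E]
      · rw [hE'' _ _ (hmono _ _ h), hpE _ _ h]
        exact ⟨fun h' => (hDt y x h.ne).resolve_left h', fun h' h'' => hDa _ _ h' h''⟩
    · intro x y
      rw [hD, hlt]
      exact hsm.lt_iff_lt
  refine ⟨⟨W.V, inferInstance⟩, ⟨W.finite, ?_, ?_, ?_⟩, ?_⟩
  · rintro x y (⟨h, h'⟩ | ⟨h, h'⟩) (⟨g, g'⟩ | ⟨g, g'⟩)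
    · exact h.not_gt g
    · exact g' h'
    · exact h' g'
    · exact h.not_gt g
  · intro x y hxy
    change E x y ∨ E y x
    rcases lt_or_gt_of_ne (hpos.ne hxy) with h | h <;> by_cases hr : W.rel x y <;>
      by_cases hr' : W.rel y x <;> simp [E, h, hr, hr']
  · exact RelEmbedding.isStrictTotalOrder (s := fun x y : Fin N ×ₗ Fin m => x < y)
      { toFun := pos, inj' := hpos, map_rel_iff' := Iff.rfl }
  · intro χ
    have hT : ∀ (e : A ↪o Fin N) (g : PartiteSystem.Transversal (fun x y => edgeRel 0 x y) e W),
        ∃ f : A ↪[expLang 0] W.V, ∀ x, f x = g.toFun x := by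
      intro e g
      refine emb A hltA hAa hAt g.toFun (fun x y h => ?_) g.rel_toFun
      rw [g.proj_toFun, g.proj_toFun]
      exact e.strictMono h
    choose τ hτ using hT
    obtain ⟨f, hf⟩ := hW fun e g => χ (τ e g)
    -- Within the image of `f` the colour depends only on the position `e`, so any representative
    -- serves. Positions without a copy of `A` get the spare colour `none`.
    obtain ⟨F, hF⟩ := hN fun e => if h : Nonempty (PartiteSystem.Transversal
      (fun x y => edgeRel 0 x y) e V) then some (χ (τ e (h.some.map f))) else none
    obtain ⟨fB, hfB⟩ := emb B hltB hBa hBt (fun y => f.toFun (F, y))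
      (fun x y h => by
        rw [f.proj_toFun, f.proj_toFun]
        exact F.strictMono h)
      (fun x y h => f.rel_toFun _ _ (F.strictMono h))
    refine ⟨fB, fun g g' => ?_⟩
    have key : ∀ g : A ↪[expLang 0] B, ∃ e : A ↪o B,
        ∃ t : PartiteSystem.Transversal (fun x y => edgeRel 0 x y) (e.trans F) V,
          fB.comp g = τ _ (t.map f) := by
      intro g
      refine ⟨OrderEmbedding.ofMapLEIff g fun x y => ?_, ⟨fun x => (F, g x), fun _ => rfl,
        fun x y _ => edgeRel_map g x y⟩, ?_⟩
      · rw [← not_lt, ← not_lt, ← hltA, ← hltB, ltRel_map]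
      · ext x
        rw [hτ]
        exact hfB _
    obtain ⟨e, t, ht⟩ := key g
    obtain ⟨e', t', ht'⟩ := key g'
    have := hF e e'
    rw [dif_pos ⟨t⟩, dif_pos ⟨t'⟩, Option.some_inj] at this
    rw [ht, ht']
    exact (hf _ _ _).trans (this.trans (hf _ _ _))

/-! ### The expanded tournaments have the Ramsey property -/

section
variable {n : ℕ} {T : Type w} [(expLang n).Structure T]

/-- A linearly ordered structure that is coded by its order and a labelling of its points, and in
which each label can be put at each of `N` positions, has the Ramsey property. -/
theorem hasEmbRamsey_of_labelling {Λ : Type} [Finite Λ] (τ : T → Λ) (Q Q' : Λ → Λ → Prop)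
    (R : Fin n → Λ → Prop) (hR : ∀ a b, (∀ i, R i a ↔ R i b) → a = b)
    (hlt : IsStrictTotalOrder T (ltRel n)) (hP : ∀ i x, partRel n i x ↔ R i (τ x))
    (hE : ∀ x y : T, edgeRel n x y ↔
      (ltRel n x y ∧ Q (τ x) (τ y)) ∨ (ltRel n y x ∧ Q' (τ x) (τ y)))
    (hp : ∀ N : ℕ, ∃ p : Fin N → Λ → T, (∀ i a, τ (p i a) = a) ∧
      ∀ i j a b, i < j → ltRel n (p i a) (p j b)) :
    HasEmbRamsey.{u} (expLang n) T := by
  classical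
  rintro k A B _ _ _ _ ⟨a⟩ ⟨b⟩
  have hA := isStrictTotalOrder_ltRel_of_embedding a hlt
  have hB := isStrictTotalOrder_ltRel_of_embedding b hlt
  let : LinearOrder A := linearOrderOfSTO (ltRel n)
  let : LinearOrder B := linearOrderOfSTO (ltRel n)
  have hltA : ∀ x y : A, ltRel n x y ↔ x < y := fun _ _ => Iff.rfl
  have hltB : ∀ x y : B, ltRel n x y ↔ x < y := fun _ _ => Iff.rfl
  obtain ⟨N, hN⟩ := exists_orderEmbedding_monochromatic A B (Fin k)
  obtain ⟨p, hpτ, hplt⟩ := hp N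
  -- `C` has every label at each of the `N` positions, so any placement of a labelled order is
  -- realised in it.
  let q : ULift.{u} (Fin N × Λ) → T := fun x => p x.down.1 x.down.2
  have hq : Function.Injective q := by
    rintro ⟨i, s⟩ ⟨j, t⟩ h
    have hst : s = t := by rw [← hpτ i s, ← hpτ j t]; exact congrArg τ h
    subst hst
    rcases lt_trichotomy i j with hij | rfl | hij
    · have := hplt i j s s hij
      rw [show p i s = p j s from h] at this
      exact absurd this (irrefl _)
    · rfl
    · have := hplt j i s s hij
      rw [show p i s = p j s from h] at this
      exact absurd this (irrefl _)
  let : (expLang n).Structure (ULift.{u} (Fin N × Λ)) :=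
    mkExp (fun x y => edgeRel n (q x) (q y)) (fun x y => ltRel n (q x) (q y))
      (fun i x => partRel n i (q x))
  refine ⟨ULift.{u} (Fin N × Λ), inferInstance, inferInstance, ⟨expEmbedding q hq
    (fun _ _ => Iff.rfl) (fun _ _ => Iff.rfl) (fun _ _ => Iff.rfl)⟩, fun χ => ?_⟩
  have emb : ∀ (D : Type u) [(expLang n).Structure D] [LinearOrder D]
      (_ : ∀ x y : D, ltRel n x y ↔ x < y) (d : D ↪[expLang n] T) (e : D ↪o Fin N),
      ∃ f : D ↪[expLang n] ULift.{u} (Fin N × Λ), ∀ x, f x = ⟨e x, τ (d x)⟩ := by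
    intro D _ _ hD d e
    have hmono : ∀ x y, ltRel n (p (e x) (τ (d x))) (p (e y) (τ (d y))) ↔ ltRel n x y := by
      intro x y
      rw [hD]
      refine ⟨fun h => ?_, fun h => hplt _ _ _ _ (e.strictMono h)⟩
      by_contra hxy
      rcases (not_lt.1 hxy).lt_or_eq with h' | rfl
      · exact asymm h (hplt _ _ _ _ (e.strictMono h'))
      · exact irrefl _ h
    refine ⟨expEmbedding (fun x => ⟨e x, τ (d x)⟩) ?_ ?_ ?_ ?_, fun _ => rfl⟩
    · intro x y h
      exact e.injective (congrArg (fun z : ULift (Fin N × Λ) => z.down.1) h)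
    · intro x y
      change edgeRel n (p (e x) (τ (d x))) (p (e y) (τ (d y))) ↔ _
      rw [← edgeRel_map d, hE, hE, hpτ, hpτ, hmono, hmono, ltRel_map, ltRel_map]
    · exact hmono
    · intro i x
      change partRel n i (p (e x) (τ (d x))) ↔ _
      rw [← partRel_map d, hP, hP, hpτ]
  choose fA hfA using emb A hltA a
  choose fB hfB using emb B hltB b
  obtain ⟨F, hF⟩ := hN fun e => χ (fA e)
  refine ⟨fB F, fun g g' => ?_⟩
  have key : ∀ g : A ↪[expLang n] B, ∃ e : A ↪o B, (fB F).comp g = fA (e.trans F) := by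
    intro g
    refine ⟨OrderEmbedding.ofMapLEIff g fun x y => ?_, Embedding.ext fun x => ?_⟩
    · rw [← not_lt, ← not_lt, ← hltA, ← hltB, ltRel_map]
    · rw [hfA, Embedding.comp_apply, hfB]
      -- The predicates determine the label, so an embedding of `A` in `B` respects labels and only
      -- the positions vary.
      have : τ (b (g x)) = τ (a x) := hR _ _ fun i => by
        rw [← hP, ← hP, partRel_map, partRel_map, partRel_map]
      rw [this]
      rfl
  obtain ⟨e, he⟩ := key g
  obtain ⟨e', he'⟩ := key g'
  rw [he, he']
  exact hF e e'

end

theorem hasEmbRamsey_rat : HasEmbRamsey.{u} (expLang 0) ℚ := by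
  refine hasEmbRamsey_of_labelling (fun _ => ()) (fun _ _ => True) (fun _ _ => False)
    (fun i => i.elim0) (fun _ _ _ => rfl) ?_ (fun i => i.elim0) ?_ ?_
  · exact inferInstanceAs (IsStrictTotalOrder ℚ (· < ·))
  · intro x y
    simp only [and_true, and_false, or_false]
    rfl
  · refine fun N => ⟨fun i _ => (i : ℕ), fun _ _ => rfl, fun i j _ _ h => ?_⟩
    change ((i : ℕ) : ℚ) < (j : ℕ)
    exact_mod_cast h

theorem hasEmbRamsey_of_isFraisseLimit {T : Type u} [(expLang 0).Structure T] [Countable T]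
    (h : IsFraisseLimit finiteOrderedTournaments.{u} T) : HasEmbRamsey.{u} (expLang 0) T := by
  rintro k A B _ _ _ _ hA hB
  have mem : ∀ (D : Type u) [(expLang 0).Structure D] [Finite D], Nonempty (D ↪[expLang 0] T) →
      (⟨D, inferInstance⟩ : Bundled (expLang 0).Structure) ∈ finiteOrderedTournaments := by
    intro D _ _ hD
    rw [← h.age]
    exact ⟨Structure.FG.of_finite, hD⟩
  obtain ⟨C, hC, hCBA⟩ :=
    exists_embArrows_of_mem_finiteOrderedTournaments k A B (mem A hA) (mem B hB)
  have hCT := hC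
  rw [← h.age] at hCT
  exact ⟨C, inferInstance, hC.1, hCT.2, hCBA⟩

/-! ### The dense local order -/

namespace LocalOrder

/-- Irrationality of `π` keeps rational angles off the vertical axis and excludes antipodal pairs.
-/
theorem eq_zero_of_mul_pi_eq {r s : ℚ} (h : (r : ℝ) * Real.pi = s) : r = 0 := by
  by_contra hr
  exact (irrational_pi.ratCast_mul hr).ne_rat s h

theorem cos_ne_zero (x : LocalOrder) : x.1.cos ≠ 0 := by
  obtain ⟨_, q, rfl⟩ := x
  rw [Real.Angle.cos_coe]
  intro h
  obtain ⟨k, hk⟩ := Real.cos_eq_zero_iff.1 h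
  have := eq_zero_of_mul_pi_eq (r := (2 * k + 1) / 2) (s := q) (by
    rw [hk]; push_cast; ring)
  have h2 : (2 * k + 1 : ℚ) = 0 := by linarith
  have h3 : (2 * k + 1 : ℤ) = 0 := by exact_mod_cast h2
  omega

/-- The slope of the line through the centre and a point. -/
noncomputable def slope (x : LocalOrder) : ℝ := x.1.sin / x.1.cos

/-- An edge is a sign condition on this sine. The factorisation separates the contribution of the
two halves from the comparison of slopes. -/
theorem sin_sub_eq (x y : LocalOrder) :
    (y.1 - x.1).sin = x.1.cos * y.1.cos * (y.slope - x.slope) := by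
  have hx := x.cos_ne_zero
  have hy := y.cos_ne_zero
  unfold slope
  field_simp
  obtain ⟨_, q, rfl⟩ := x
  obtain ⟨_, q', rfl⟩ := y
  simp only [← Real.Angle.coe_sub, Real.Angle.sin_coe, Real.Angle.cos_coe, Real.sin_sub]
  ring

theorem edge_iff (x y : LocalOrder) :
    x.edge y ↔ 0 < x.1.cos * y.1.cos * (y.slope - x.slope) := by
  rw [← sin_sub_eq, edge, ← Real.Angle.sin_toReal]
  set t := (y.1 - x.1).toReal
  have h1 : -Real.pi < t := Real.Angle.neg_pi_lt_toReal _
  have h2 : t ≤ Real.pi := Real.Angle.toReal_le_pi _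
  refine ⟨fun h => Real.sin_pos_of_pos_of_lt_pi h.1 h.2, fun h => ⟨?_, ?_⟩⟩
  · by_contra! h0
    exact absurd h (Real.sin_nonpos_of_nonpos_of_neg_pi_le h0 h1.le).not_gt
  · refine h2.lt_of_ne fun h0 => ?_
    rw [h0, Real.sin_pi] at h
    exact lt_irrefl _ h

/-- The product of the cosines is negative exactly for points in different halves, and the reversal
of the edges there cancels this sign. -/
theorem lt_iff (x y : LocalOrder) : x.lt y ↔ x.slope < y.slope := by
  have hx := x.cos_ne_zero
  have hy := y.cos_ne_zero
  unfold lt right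
  rw [edge_iff, edge_iff]
  rcases hx.lt_or_gt with hx | hx <;> rcases hy.lt_or_gt with hy | hy
  · simp [hx.not_gt, hy.not_gt, mul_pos_iff_of_pos_left (mul_pos_of_neg_of_neg hx hy)]
  · have := mul_pos (neg_pos.2 hx) hy
    simp only [hx.not_gt, hy, false_iff, not_true_eq_false, false_and, not_false_eq_true,
      true_and, false_or]
    rw [show y.1.cos * x.1.cos * (x.slope - y.slope) =
      (-x.1.cos * y.1.cos) * (y.slope - x.slope) by ring, mul_pos_iff_of_pos_left this, sub_pos]
  · have := mul_pos hx (neg_pos.2 hy)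
    simp only [hy.not_gt, hx, iff_false, not_true_eq_false, false_and, not_false_eq_true,
      true_and, false_or]
    rw [show y.1.cos * x.1.cos * (x.slope - y.slope) =
      (x.1.cos * -y.1.cos) * (y.slope - x.slope) by ring, mul_pos_iff_of_pos_left this, sub_pos]
  · simp [hx, hy, mul_pos_iff_of_pos_left (mul_pos hx hy)]

theorem edge_iff_lt (x y : LocalOrder) :
    x.edge y ↔ (x.lt y ∧ (x.right ↔ y.right)) ∨ (y.lt x ∧ ¬ (x.right ↔ y.right)) := by
  unfold lt
  by_cases h : x.right ↔ y.right
  · simp [h]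
  · have h' : ¬ (y.right ↔ x.right) := fun h' => h h'.symm
    simp [h, h']

theorem slope_injective : Function.Injective slope := by
  intro x y h
  have := sin_sub_eq x y
  rw [h, sub_self, mul_zero] at this
  obtain ⟨_, q, rfl⟩ := x
  obtain ⟨_, q', rfl⟩ := y
  rw [← Real.Angle.coe_sub, Real.Angle.sin_coe, Real.sin_eq_zero_iff] at this
  obtain ⟨k, hk⟩ := this
  have hk0 := eq_zero_of_mul_pi_eq (r := k) (s := q' - q) (by push_cast; exact hk)
  have hk1 : ((k : ℤ) : ℝ) = 0 := by exact_mod_cast hk0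
  rw [hk1, zero_mul] at hk
  have : (q : ℝ) = q' := by linarith
  exact Subtype.ext (congrArg (fun r : ℝ => (r : Real.Angle)) this)

theorem exists_slope_mem_Ioo {c d : ℝ} (h : c < d) (b : Prop) :
    ∃ x : LocalOrder, (x.right ↔ b) ∧ c < x.slope ∧ x.slope < d := by
  have harc := Real.arctan_strictMono h
  have slope_of : ∀ t : ℝ, Real.arctan c < t → t < Real.arctan d →
      0 < Real.cos t ∧ c < Real.sin t / Real.cos t ∧ Real.sin t / Real.cos t < d := by
    intro t h1 h2
    have h3 := (Real.neg_pi_div_two_lt_arctan c).trans h1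
    have h4 := h2.trans (Real.arctan_lt_pi_div_two d)
    refine ⟨Real.cos_pos_of_mem_Ioo ⟨h3, h4⟩, ?_, ?_⟩
    · rw [← Real.tan_eq_sin_div_cos]
      conv_lhs => rw [← Real.tan_arctan c]
      exact Real.strictMonoOn_tan ⟨Real.neg_pi_div_two_lt_arctan c,
        Real.arctan_lt_pi_div_two c⟩ ⟨h3, h4⟩ h1
    · rw [← Real.tan_eq_sin_div_cos]
      conv_rhs => rw [← Real.tan_arctan d]
      exact Real.strictMonoOn_tan ⟨h3, h4⟩ ⟨Real.neg_pi_div_two_lt_arctan d,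
        Real.arctan_lt_pi_div_two d⟩ h2
  by_cases hb : b
  · obtain ⟨q, h1, h2⟩ := exists_rat_btwn harc
    obtain ⟨h3, h4⟩ := slope_of q h1 h2
    refine ⟨⟨((q : ℝ) : Real.Angle), q, rfl⟩, ?_, ?_⟩
    · simp only [right, Real.Angle.cos_coe, h3, hb]
    · simpa only [slope, Real.Angle.cos_coe, Real.Angle.sin_coe] using h4
  -- Rotation by `π` preserves slopes but not rationality of angles, so the rational is chosen in
  -- the rotated interval.
  · obtain ⟨q, h1, h2⟩ := exists_rat_btwn (add_lt_add_left harc Real.pi)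
    obtain ⟨h3, h4⟩ := slope_of (q - Real.pi) (by linarith) (by linarith)
    rw [Real.cos_sub_pi] at h3
    rw [Real.cos_sub_pi, Real.sin_sub_pi, neg_div_neg_eq] at h4
    refine ⟨⟨((q : ℝ) : Real.Angle), q, rfl⟩, ?_, ?_⟩
    · simp only [right, Real.Angle.cos_coe, hb, iff_false]
      linarith
    · simpa only [slope, Real.Angle.cos_coe, Real.Angle.sin_coe] using h4

theorem hasEmbRamsey : HasEmbRamsey.{u} (expLang 2) LocalOrder := by
  classical
  refine hasEmbRamsey_of_labelling (fun x => decide x.right) (fun a b => a = b)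
    (fun a b => a ≠ b) ![fun a => a = false, fun a => a = true] ?_ ?_ ?_ ?_ ?_
  · intro a b h
    have := h 1
    simp at this
    exact this
  · exact RelEmbedding.isStrictTotalOrder (s := fun x y : ℝ => x < y)
      { toFun := slope, inj' := slope_injective, map_rel_iff' := fun {x y} => (lt_iff x y).symm }
  · intro i x
    fin_cases i
    · change x.1.cos < 0 ↔ decide x.right = false
      rw [decide_eq_false_iff_not, right, not_lt]
      exact ⟨le_of_lt, fun h => h.lt_of_ne x.cos_ne_zero⟩
    · change 0 < x.1.cos ↔ decide x.right = true
      rw [decide_eq_true_iff, right]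
  · intro x y
    simp only [ne_eq, decide_eq_decide]
    exact edge_iff_lt x y
  · intro N
    -- Position `i` is the set of points with slope in `(i, i + 1)`, which meets both halves.
    choose p hp hp1 hp2 using fun (i : Fin N) (a : Bool) =>
      exists_slope_mem_Ioo (lt_add_one ((i : ℕ) : ℝ)) (a = true)
    refine ⟨p, fun i a => ?_, fun i j a b h => ?_⟩
    · rw [Bool.eq_iff_iff, decide_eq_true_iff]
      exact hp i a
    · refine (lt_iff _ _).2 ((hp2 i a).trans_le (le_trans ?_ (hp1 j b).le))
      exact_mod_cast Nat.succ_le_of_lt h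

theorem edge_or_edge {x y : LocalOrder} (h : x ≠ y) : x.edge y ∨ y.edge x := by
  rw [edge_iff, edge_iff]
  have := mul_ne_zero (mul_ne_zero x.cos_ne_zero y.cos_ne_zero)
    (sub_ne_zero.2 (slope_injective.ne h.symm))
  rcases this.lt_or_gt with h | h
  · right; linarith
  · left; exact h

end LocalOrder

namespace IsExpandedHomogeneousTournament

theorem hasEmbRamsey {n : ℕ} {T : Type u} [(expLang n).Structure T]
    (hT : IsExpandedHomogeneousTournament n T) : HasEmbRamsey.{u} (expLang n) T := by
  cases hT with
  | point _ h =>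
    obtain ⟨e⟩ := h
    refine HasEmbRamsey.of_equiv (hasEmbRamsey_of_partRel_separates fun _ _ _ => rfl) e
  | cycle _ r hr h =>
    obtain ⟨e⟩ := h
    refine HasEmbRamsey.of_equiv (hasEmbRamsey_of_partRel_separates fun x y h => ?_) e
    exact ((h x).1 rfl).symm
  | rational _ h => exact h.elim hasEmbRamsey_rat.of_equiv
  | localOrder _ h => exact h.elim LocalOrder.hasEmbRamsey.of_equiv
  | generic _ h => exact hasEmbRamsey_of_isFraisseLimit h

/-- This makes the parts of the product definable from the edges, so that embeddings respect them.
-/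
theorem edgeRel_or_edgeRel {n : ℕ} {T : Type u} [(expLang n).Structure T]
    (hT : IsExpandedHomogeneousTournament n T) {x y : T} (hxy : x ≠ y) :
    edgeRel n x y ∨ edgeRel n y x := by
  cases hT with
  | point _ h =>
    obtain ⟨e⟩ := h
    exact absurd (e.injective (Subsingleton.elim (α := Unit) _ _)) hxy
  | cycle _ r hr h =>
    obtain ⟨e⟩ := h
    rw [← edgeRel_map e.toEmbedding, ← edgeRel_map e.toEmbedding]
    have : ∀ a b : Fin 3, a ≠ b → b = a + 1 ∨ a = b + 1 := by decide
    exact this _ _ (e.injective.ne hxy)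
  | rational _ h =>
    obtain ⟨e⟩ := h
    rw [← edgeRel_map e.toEmbedding, ← edgeRel_map e.toEmbedding]
    exact lt_or_gt_of_ne (e.injective.ne hxy)
  | localOrder _ h =>
    obtain ⟨e⟩ := h
    rw [← edgeRel_map e.toEmbedding, ← edgeRel_map e.toEmbedding]
    exact LocalOrder.edge_or_edge (e.injective.ne hxy)
  | generic _ h =>
    let S := Substructure.closure (expLang 0) ({x, y} : Set T)
    have hS : (⟨S, inferInstance⟩ : Bundled (expLang 0).Structure) ∈ finiteOrderedTournaments := by
      rw [← h.age]
      exact ⟨(Substructure.fg_iff_structure_fg S).1 (Substructure.fg_closure (by simp)),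
        ⟨S.subtype⟩⟩
    have hx : x ∈ S := Substructure.subset_closure (by simp)
    have hy : y ∈ S := Substructure.subset_closure (by simp)
    have := hS.2.2.1 ⟨x, hx⟩ ⟨y, hy⟩ (fun h => hxy (congrArg Subtype.val h))
    rwa [← edgeRel_map S.subtype, ← edgeRel_map S.subtype] at this

end IsExpandedHomogeneousTournament

/-! ### Product arguments -/

instance {L : FirstOrder.Language.{0, 0}} {A : Type u} {B : Type v} [L.Structure A]
    [L.Structure B] [Finite A] [Finite B] : Finite (A ↪[L] B) :=
  Finite.of_injective _ DFunLike.coe_injective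

section
variable {L : FirstOrder.Language.{0, 0}} {T : Type w} [L.Structure T]

/-- The product Ramsey theorem. -/
theorem HasEmbRamsey.exists_pi (hT : HasEmbRamsey.{u} L T) (κ : Type v) [Finite κ] [Nonempty κ]
    (N : ℕ) (A D : Fin N → Bundled.{u} L.Structure) (hA : ∀ s, Finite (A s))
    (hD : ∀ s, Finite (D s)) (hAT : ∀ s, Nonempty (A s ↪[L] T))
    (hDT : ∀ s, Nonempty (D s ↪[L] T)) :
    ∃ C : Fin N → Bundled.{u} L.Structure, (∀ s, Finite (C s)) ∧
      (∀ s, Nonempty (C s ↪[L] T)) ∧ ∀ χ : (∀ s, A s ↪[L] C s) → κ, ∃ f : ∀ s, D s ↪[L] C s,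
        ∀ g g' : ∀ s, A s ↪[L] D s,
          χ (fun s => (f s).comp (g s)) = χ (fun s => (f s).comp (g' s)) := by
  induction N with
  | zero =>
    refine ⟨D, hD, hDT, fun χ => ⟨fun s => s.elim0, fun g g' => ?_⟩⟩
    exact congrArg χ (funext fun s => s.elim0)
  | succ N ih =>
    obtain ⟨C, hC, hCT, h⟩ := ih (fun s => A s.succ) (fun s => D s.succ) (fun s => hA _)
      (fun s => hD _) (fun s => hAT _) (fun s => hDT _)
    have := hA 0
    have := hD 0
    have := fun s : Fin N => hA s.succ
    -- The colour of an embedding in the first factor is the whole induced colouring of the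
    -- remaining factors, whose `C` is already fixed.
    obtain ⟨C₀, i₀, hC₀, hC₀T, h₀⟩ := hT (Nat.card ((∀ s : Fin N, A s.succ ↪[L] C s) → κ))
      (A 0) (D 0) (hAT 0) (hDT 0)
    let C' : Fin (N + 1) → Bundled.{u} L.Structure := Fin.cases ⟨C₀, i₀⟩ C
    refine ⟨C', Fin.cases hC₀ hC, Fin.cases hC₀T hCT, fun χ => ?_⟩
    let pair : (A 0 ↪[L] C₀) → (∀ s : Fin N, A s.succ ↪[L] C s) → ∀ s, A s ↪[L] C' s :=
      fun g h => Fin.cases g h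
    obtain ⟨f₀, hf₀⟩ := h₀.of_finite fun g h => χ (pair g h)
    by_cases hg : Nonempty (A 0 ↪[L] D 0)
    · obtain ⟨g₀⟩ := hg
      obtain ⟨f, hf⟩ := h fun h => χ (pair (f₀.comp g₀) h)
      let f' : ∀ s, D s ↪[L] C' s := Fin.cases f₀ f
      have key : ∀ g : ∀ s, A s ↪[L] D s, χ (fun s => (f' s).comp (g s)) =
          χ (pair (f₀.comp g₀) fun s => (f s).comp (g s.succ)) := by
        intro g
        refine Eq.trans (congrArg χ (funext fun s => ?_))
          (congrFun (hf₀ (g 0) g₀) fun s => (f s).comp (g s.succ))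
        cases s using Fin.cases <;> rfl
      refine ⟨f', fun g g' => ?_⟩
      rw [key, key]
      exact hf (fun s => g s.succ) (fun s => g' s.succ)
    -- With no embedding in the first factor only the existence of `f` matters, and any colouring
    -- produces one.
    · obtain ⟨f, -⟩ := h fun _ => Classical.arbitrary κ
      exact ⟨Fin.cases f₀ f, fun g => absurd ⟨g 0⟩ hg⟩

/-- The product Ramsey theorem for finitely many families at the same time. -/
theorem HasEmbRamsey.exists_pi_forall (hT : HasEmbRamsey.{u} L T) (κ : Type v) [Finite κ]
    [Nonempty κ] {N : ℕ} {Φ : Type} [Finite Φ] (A : Φ → Fin N → Bundled.{u} L.Structure)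
    (D : Fin N → Bundled.{u} L.Structure) (hA : ∀ φ s, Finite (A φ s))
    (hD : ∀ s, Finite (D s)) (hAT : ∀ φ s, Nonempty (A φ s ↪[L] T))
    (hDT : ∀ s, Nonempty (D s ↪[L] T)) :
    ∃ C : Fin N → Bundled.{u} L.Structure, (∀ s, Finite (C s)) ∧
      (∀ s, Nonempty (C s ↪[L] T)) ∧ ∀ χ : (φ : Φ) → (∀ s, A φ s ↪[L] C s) → κ,
        ∃ f : ∀ s, D s ↪[L] C s, ∀ (φ : Φ) (g g' : ∀ s, A φ s ↪[L] D s),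
          χ φ (fun s => (f s).comp (g s)) = χ φ (fun s => (f s).comp (g' s)) := by
  classical
  have := Fintype.ofFinite Φ
  suffices H : ∀ S : Finset Φ, ∃ C : Fin N → Bundled.{u} L.Structure, (∀ s, Finite (C s)) ∧
      (∀ s, Nonempty (C s ↪[L] T)) ∧ ∀ χ : (φ : Φ) → (∀ s, A φ s ↪[L] C s) → κ,
        ∃ f : ∀ s, D s ↪[L] C s, ∀ φ ∈ S, ∀ g g' : ∀ s, A φ s ↪[L] D s,
          χ φ (fun s => (f s).comp (g s)) = χ φ (fun s => (f s).comp (g' s)) by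
    simpa using H Finset.univ
  intro S
  induction S using Finset.induction_on with
  | empty => exact ⟨D, hD, hDT, fun χ => ⟨fun s => Embedding.refl L _, by simp⟩⟩
  | insert φ₀ S _ ih =>
    obtain ⟨C₁, hC₁, hC₁T, h₁⟩ := ih
    obtain ⟨C₂, hC₂, hC₂T, h₂⟩ := hT.exists_pi κ N (A φ₀) C₁ (hA φ₀) hC₁ (hAT φ₀) hC₁T
    refine ⟨C₂, hC₂, hC₂T, fun χ => ?_⟩
    obtain ⟨f₂, hf₂⟩ := h₂ (χ φ₀)
    obtain ⟨f₁, hf₁⟩ := h₁ fun φ g => χ φ fun s => (f₂ s).comp (g s)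
    refine ⟨fun s => (f₂ s).comp (f₁ s), fun φ hφ g g' => ?_⟩
    rcases Finset.mem_insert.1 hφ with rfl | hφ
    · exact hf₂ (fun s => (f₁ s).comp (g s)) (fun s => (f₁ s).comp (g' s))
    · exact hf₁ φ hφ g g'

end

/-! ### Lexicographic products -/

section
variable {n : ℕ}

/-- The structure that a map induces on its domain. -/
@[reducible] def inducedStructure {D : Type v} {M : Type w} [(expLang n).Structure M] (f : D → M) :
    (expLang n).Structure D :=
  mkExp (fun x y => edgeRel n (f x) (f y)) (fun x y => ltRel n (f x) (f y))
    (fun i x => partRel n i (f x))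

variable (n) in
/-- `M` is by `x ↦ (p x, q x)` a substructure of the lexicographic product of a linear order `X`
with `T`, in which points in different parts have no edge. -/
structure IsLexDecomposition {M X T : Type*} [(expLang n).Structure M] [(expLang n).Structure T]
    [LinearOrder X] (p : M → X) (q : M → T) : Prop where
  inj : ∀ x y, p x = p y → q x = q y → x = y
  edge : ∀ x y, edgeRel n x y ↔ p x = p y ∧ edgeRel n (q x) (q y)
  lt : ∀ x y, ltRel n x y ↔ p x < p y ∨ (p x = p y ∧ ltRel n (q x) (q y))
  part : ∀ i x, partRel n i x ↔ partRel n i (q x)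

namespace IsLexDecomposition

variable {M X T : Type*} [(expLang n).Structure M] [(expLang n).Structure T] [LinearOrder X]
  {p : M → X} {q : M → T}

theorem comp (h : IsLexDecomposition n p q) {A Y : Type*} [(expLang n).Structure A] [LinearOrder Y]
    (a : A ↪[expLang n] M) (p' : A → Y) (e : Y ↪o X) (hp : ∀ x, e (p' x) = p (a x)) :
    IsLexDecomposition n p' (fun x => q (a x)) where
  inj x y h1 h2 := a.injective (h.inj _ _ (by rw [← hp, ← hp, h1]) h2)
  edge x y := by rw [← edgeRel_map a, h.edge, ← hp, ← hp, e.injective.eq_iff]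
  lt x y := by rw [← ltRel_map a, h.lt, ← hp, ← hp, e.injective.eq_iff, e.lt_iff_lt]
  part i x := by rw [← partRel_map a, h.part]

theorem part_eq_iff (h : IsLexDecomposition n p q)
    (hT : ∀ x y : T, x ≠ y → edgeRel n x y ∨ edgeRel n y x) (x y : M) :
    p x = p y ↔ x = y ∨ edgeRel n x y ∨ edgeRel n y x := by
  constructor
  · intro hp
    by_cases hq : q x = q y
    · exact Or.inl (h.inj _ _ hp hq)
    · exact Or.inr ((hT _ _ hq).imp (fun h' => (h.edge _ _).2 ⟨hp, h'⟩)
        (fun h' => (h.edge _ _).2 ⟨hp.symm, h'⟩))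
  · rintro (rfl | h' | h')
    · rfl
    · exact ((h.edge _ _).1 h').1
    · exact ((h.edge _ _).1 h').1.symm

theorem part_lt_iff (h : IsLexDecomposition n p q) (x y : M) :
    p x < p y ↔ ltRel n x y ∧ p x ≠ p y := by
  rw [h.lt]
  constructor
  · exact fun h' => ⟨Or.inl h', h'.ne⟩
  · rintro ⟨h' | h', h''⟩
    · exact h'
    · exact absurd h'.1 h''

/-- Embeddings induce embeddings of the linear orders of the parts. -/
theorem exists_orderEmbedding (h : IsLexDecomposition n p q)
    (hT : ∀ x y : T, x ≠ y → edgeRel n x y ∨ edgeRel n y x) {A Y : Type*} [(expLang n).Structure A]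
    [LinearOrder Y] {p' : A → Y} {q' : A → T} (h' : IsLexDecomposition n p' q')
    (hp' : Function.Surjective p') (g : A ↪[expLang n] M) :
    ∃ e : Y ↪o X, ∀ x, e (p' x) = p (g x) := by
  have heq : ∀ x y, p (g x) = p (g y) ↔ p' x = p' y := by
    intro x y
    rw [h.part_eq_iff hT, h'.part_eq_iff hT, edgeRel_map, edgeRel_map, g.injective.eq_iff]
  have hlt : ∀ x y, p (g x) < p (g y) ↔ p' x < p' y := by
    intro x y
    rw [h.part_lt_iff, h'.part_lt_iff, ltRel_map, ne_eq, heq]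
  choose r hr using hp'
  refine ⟨OrderEmbedding.ofStrictMono (fun i => p (g (r i))) fun i j hij => ?_, fun x => ?_⟩
  · rwa [hlt, hr, hr]
  · exact (heq _ _).2 (hr _)

/-- The part of `M` at the position `s` for a placement `φ` of the parts. -/
@[ext] structure PartAt (p : M → X) {N : ℕ} (φ : X ↪o Fin N) (s : Fin N) where
  /-- The point. -/
  val : M
  property : φ (p val) = s

instance {N : ℕ} (φ : X ↪o Fin N) (s : Fin N) : (expLang n).Structure (PartAt p φ s) :=
  inducedStructure PartAt.val

instance [Finite M] {N : ℕ} (φ : X ↪o Fin N) (s : Fin N) : Finite (PartAt p φ s) :=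
  Finite.of_injective PartAt.val fun _ _ => PartAt.ext

/-- A part of `M` is a substructure of `T`. -/
theorem exists_embedding_partAt (h : IsLexDecomposition n p q) {N : ℕ} (φ : X ↪o Fin N)
    (s : Fin N) : ∃ f : PartAt p φ s ↪[expLang n] T, ∀ x, f x = q x.1 := by
  have hp : ∀ x y : PartAt p φ s, p x.1 = p y.1 := fun x y =>
    φ.injective (x.2.trans y.2.symm)
  refine ⟨expEmbedding (fun x => q x.1) (fun x y hxy => PartAt.ext (h.inj _ _ (hp x y) hxy))
    (fun x y => ?_) (fun x y => ?_) (fun i x => (h.part i x.1).symm), fun _ => rfl⟩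
  · change _ ↔ edgeRel n x.1 y.1
    rw [h.edge]
    exact (and_iff_right (hp x y)).symm
  · change _ ↔ ltRel n x.1 y.1
    rw [h.lt, hp x y]
    simp

/-- Embeddings of the parts of `M` in the parts of a lexicographic sum form an embedding. -/
theorem exists_glue (h : IsLexDecomposition n p q) {N : ℕ}
    {C : Fin N → Bundled.{v} (expLang n).Structure} [(expLang n).Structure (Σ s, C s)]
    {c : ∀ s, C s ↪[expLang n] T}
    (hC : IsLexDecomposition n (M := Σ s, C s) Sigma.fst (fun x => c x.1 x.2))
    (φ : X ↪o Fin N) (f : ∀ s, PartAt p φ s ↪[expLang n] C s) :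
    ∃ F : M ↪[expLang n] (Σ s, C s), ∀ x, F x = ⟨φ (p x), f _ ⟨x, rfl⟩⟩ := by
  -- Transport along an equality of positions, so that points of the same part can be compared
  -- through a single `f s`.
  have hc : ∀ (x : M) (s : Fin N) (hs : φ (p x) = s),
      c (φ (p x)) (f _ ⟨x, rfl⟩) = c s (f s ⟨x, hs⟩) := by
    rintro x _ rfl
    rfl
  refine ⟨expEmbedding (fun x => ⟨φ (p x), f _ ⟨x, rfl⟩⟩) ?_ ?_ ?_ ?_, fun _ => rfl⟩
  · intro x y hxy
    have h1 : φ (p x) = φ (p y) := congrArg Sigma.fst hxy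
    have h2 : c (φ (p x)) (f _ ⟨x, rfl⟩) = c (φ (p y)) (f _ ⟨y, rfl⟩) :=
      congrArg (fun z : Σ s, C s => c z.1 z.2) hxy
    rw [hc x _ h1] at h2
    exact congrArg PartAt.val ((f _).injective ((c _).injective h2))
  · intro x y
    rw [hC.edge]
    constructor
    · rintro ⟨h1, h2⟩
      simp only at h1 h2
      rw [hc x _ h1, edgeRel_map, edgeRel_map] at h2
      exact h2
    · intro hxy
      have h1 := congrArg φ ((h.edge _ _).1 hxy).1
      refine ⟨h1, ?_⟩
      simp only
      rw [hc x _ h1, edgeRel_map, edgeRel_map]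
      exact hxy
  · intro x y
    rw [hC.lt]
    simp only [φ.lt_iff_lt]
    constructor
    · rintro (h1 | ⟨h1, h2⟩)
      · exact (h.lt _ _).2 (Or.inl h1)
      · rw [hc x _ h1, ltRel_map, ltRel_map] at h2
        exact h2
    · intro hxy
      rcases (h.lt _ _).1 hxy with h1 | ⟨h1, -⟩
      · exact Or.inl h1
      · refine Or.inr ⟨congrArg φ h1, ?_⟩
        rw [hc x _ (congrArg φ h1), ltRel_map, ltRel_map]
        exact hxy
  · intro i x
    rw [hC.part, partRel_map, partRel_map]
    rfl

end IsLexDecomposition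

open IsLexDecomposition in
/-- The Ramsey property is inherited by lexicographic products. -/
theorem HasEmbRamsey.exists_embArrows {T : Type u} [(expLang n).Structure T]
    (hT : HasEmbRamsey.{u} (expLang n) T)
    (hE : ∀ x y : T, x ≠ y → edgeRel n x y ∨ edgeRel n y x) (k : ℕ) [NeZero k] (A B : Type u)
    [(expLang n).Structure A] [(expLang n).Structure B] [Finite A] [Finite B] {X Y : Type}
    [LinearOrder X] [LinearOrder Y] [Finite X] [Finite Y] {pA : A → X} {qA : A → T} {pB : B → Y}
    {qB : B → T} (hA : IsLexDecomposition n pA qA) (hB : IsLexDecomposition n pB qB)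
    (hpA : Function.Surjective pA) :
    ∃ (C : Type u) (_ : (expLang n).Structure C) (N : ℕ) (p : C → Fin N) (q : C → T),
      Finite C ∧ IsLexDecomposition n p q ∧ EmbArrows (expLang n) C B A k := by
  obtain ⟨N, hN⟩ := exists_orderEmbedding_monochromatic X Y (Fin k)
  have : Finite (X ↪o Fin N) := Finite.of_injective _ DFunLike.coe_injective
  -- One finite piece of `T` that contains every part of `A` and of `B`, and so can be used at all
  -- positions.
  let D : Type u := {t : T // t ∈ Set.range qA ∪ Set.range qB}
  let : (expLang n).Structure D :=
    inducedStructure (Subtype.val : {t : T // t ∈ Set.range qA ∪ Set.range qB} → T)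
  have hDfin : Finite D :=
    ((Set.finite_range qA).union (Set.finite_range qB)).to_subtype
  let dT : D ↪[expLang n] T := expEmbedding Subtype.val Subtype.val_injective (fun _ _ => Iff.rfl)
    (fun _ _ => Iff.rfl) (fun _ _ => Iff.rfl)
  have restrict : ∀ (P : Type u) [(expLang n).Structure P] (f : P ↪[expLang n] T)
      (_ : ∀ x, f x ∈ Set.range qA ∪ Set.range qB), Nonempty (P ↪[expLang n] D) :=
    fun P _ f hf => ⟨expEmbedding (fun x => ⟨f x, hf x⟩)
      (fun x y h => f.injective (congrArg Subtype.val h)) (fun x y => edgeRel_map f x y)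
      (fun x y => ltRel_map f x y) (fun i x => partRel_map f i x)⟩
  have ιA : ∀ (φ : X ↪o Fin N) (s : Fin N), PartAt pA φ s ↪[expLang n] D := fun φ s =>
    let ⟨f, hf⟩ := Classical.indefiniteDescription _ (hA.exists_embedding_partAt φ s)
    (restrict _ f fun x => Or.inl ⟨x.val, (hf x).symm⟩).some
  have ιB : ∀ (φ : Y ↪o Fin N) (s : Fin N), PartAt pB φ s ↪[expLang n] D := fun φ s =>
    let ⟨f, hf⟩ := Classical.indefiniteDescription _ (hB.exists_embedding_partAt φ s)
    (restrict _ f fun x => Or.inr ⟨x.val, (hf x).symm⟩).some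
  obtain ⟨C, hC, hCT, hCD⟩ := hT.exists_pi_forall (Fin k)
    (fun (φ : X ↪o Fin N) s => ⟨PartAt pA φ s, inferInstance⟩)
    (fun _ => ⟨D, inferInstance⟩)
    (fun φ s => inferInstanceAs (Finite (PartAt pA φ s))) (fun _ => hDfin)
    (fun φ s => ⟨dT.comp (ιA φ s)⟩) (fun _ => ⟨dT⟩)
  have c : ∀ s, C s ↪[expLang n] T := fun s => (hCT s).some
  let : (expLang n).Structure (Σ s, C s) :=
    mkExp (fun x y => x.1 = y.1 ∧ edgeRel n (c x.1 x.2) (c y.1 y.2))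
      (fun x y => x.1 < y.1 ∨ (x.1 = y.1 ∧ ltRel n (c x.1 x.2) (c y.1 y.2)))
      (fun i x => partRel n i (c x.1 x.2))
  have hlex : IsLexDecomposition n (M := Σ s, C s) Sigma.fst (fun x => c x.1 x.2) := by
    refine ⟨?_, fun _ _ => Iff.rfl, fun _ _ => Iff.rfl, fun _ _ => Iff.rfl⟩
    rintro ⟨s, x⟩ ⟨s', y⟩ h1 h2
    cases h1
    exact congrArg _ ((c s).injective h2)
  refine ⟨Σ s, C s, inferInstance, N, Sigma.fst, _, inferInstance, hlex, fun χ => ?_⟩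
  choose glueA hglueA using hA.exists_glue hlex
  -- Now the colour of a glued copy of `A` whose parts factor through `f` depends only on the
  -- placement `φ`; the embeddings `ιA` serve as representatives.
  obtain ⟨f, hf⟩ := hCD fun φ h => χ (glueA φ h)
  obtain ⟨F, hF⟩ := hN fun φ => χ (glueA φ fun s => (f s).comp (ιA φ s))
  obtain ⟨fB, hfB⟩ := hB.exists_glue hlex F fun s => (f s).comp (ιB F s)
  have key : ∀ g : A ↪[expLang n] B, ∃ e : X ↪o Y,
      χ (fB.comp g) = χ (glueA (e.trans F) fun s => (f s).comp (ιA (e.trans F) s)) := by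
    intro g
    obtain ⟨e, he⟩ := hB.exists_orderEmbedding hE hA hpA g
    have hFe : ∀ x, F (pB (g x)) = (e.trans F) (pA x) := fun x => congrArg F (he x).symm
    let g' : ∀ s, PartAt pA (e.trans F) s ↪[expLang n] PartAt pB F s := fun s =>
      expEmbedding (fun x => ⟨g x.1, (hFe x.1).trans x.2⟩)
        (fun x y h => PartAt.ext (g.injective (congrArg PartAt.val h)))
        (fun x y => edgeRel_map g x.1 y.1) (fun x y => ltRel_map g x.1 y.1)
        (fun i x => partRel_map g i x.1)
    refine ⟨e, Eq.trans (congrArg χ (Embedding.ext fun x => ?_))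
      (hf (e.trans F) (fun s => (ιB F s).comp (g' s)) (ιA (e.trans F)))⟩
    rw [hglueA, Embedding.comp_apply, hfB]
    have : ∀ (y : B) (s : Fin N) (hs : F (pB y) = s),
        (⟨F (pB y), f _ (ιB F _ ⟨y, rfl⟩)⟩ : Σ s, C s) = ⟨s, f s (ιB F s ⟨y, hs⟩)⟩ := by
      rintro y _ rfl
      rfl
    exact this (g x) _ (hFe x)
  refine ⟨fB, fun g g' => ?_⟩
  obtain ⟨e, he⟩ := key g
  obtain ⟨e', he'⟩ := key g'
  rw [he, he']
  exact hF e e'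

/-- The lexicographic product of an infinite linear order with `T` has the Ramsey property
if `T` has. -/
theorem HasEmbRamsey.of_isLexDecomposition {T : Type u} [(expLang n).Structure T]
    (hT : HasEmbRamsey.{u} (expLang n) T)
    (hE : ∀ x y : T, x ≠ y → edgeRel n x y ∨ edgeRel n y x) {X : Type} [LinearOrder X] [Infinite X]
    {M : Type u} [(expLang n).Structure M] {p : M → X} {q : M → T} (h : IsLexDecomposition n p q)
    (r : X → T → M) (hp : ∀ i t, p (r i t) = i) (hq : ∀ i t, q (r i t) = t) :
    HasEmbRamsey.{u} (expLang n) M := by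
  rintro k A B _ _ _ _ ⟨a⟩ ⟨b⟩
  rcases Nat.eq_zero_or_pos k with rfl | hk
  · exact ⟨B, inferInstance, inferInstance, ⟨b⟩, fun χ =>
      ⟨Embedding.refl _ _, fun g => (χ g).elim0⟩⟩
  have : NeZero k := ⟨hk.ne'⟩
  obtain ⟨C, _, N, pC, qC, hC, hlex, harr⟩ := hT.exists_embArrows hE k A B
    (h.comp a (Set.rangeFactorization fun x => p (a x)) (OrderEmbedding.subtype _) fun _ => rfl)
    (h.comp b (Set.rangeFactorization fun x => p (b x)) (OrderEmbedding.subtype _) fun _ => rfl)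
    Set.rangeFactorization_surjective
  refine ⟨C, inferInstance, hC, ?_, harr⟩
  -- An infinite linear order contains a chain of `N` parts, each a full copy of `T`, to receive
  -- `C`.
  obtain ⟨S, hS⟩ := Infinite.exists_subset_card_eq X N
  let e : Fin N ↪o X := S.orderEmbOfFin hS
  refine ⟨expEmbedding (fun x => r (e (pC x)) (qC x)) ?_ ?_ ?_ ?_⟩
  · intro x y hxy
    refine hlex.inj _ _ (e.injective ?_) ?_
    · rw [← hp (e (pC x)) (qC x), ← hp (e (pC y)) (qC y)]
      exact congrArg p hxy
    · rw [← hq (e (pC x)) (qC x), ← hq (e (pC y)) (qC y)]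
      exact congrArg q hxy
  · intro x y
    rw [h.edge, hlex.edge, hp, hp, hq, hq, e.injective.eq_iff]
  · intro x y
    rw [h.lt, hlex.lt, hp, hp, hq, hq, e.injective.eq_iff, e.lt_iff_lt]
  · intro i x
    rw [h.part, hlex.part, hq]

end

theorem mainTheorem11 {n : ℕ} (T : Type u) [(expLang n).Structure T]
    (hT : IsExpandedHomogeneousTournament n T)
    (prec : ℕ → ℕ → Prop) (hprec : IsStrictTotalOrder ℕ prec)
    (hdense : ∀ i j : ℕ, prec i j → ∃ k : ℕ, prec i k ∧ prec k j) :
    RamseyProperty (expLang n) ((expLang n).age (IOmega prec T)) := by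
  classical
  refine HasEmbRamsey.ramseyProperty_age ?_
  -- The instance is given explicitly, because the parts are ordered by `prec` and not by the usual
  -- order of `ℕ`.
  refine @HasEmbRamsey.of_isLexDecomposition n T _ hT.hasEmbRamsey
    (fun _ _ => hT.edgeRel_or_edgeRel) ℕ (linearOrderOfSTO prec) inferInstance (IOmega prec T) _
    Prod.fst Prod.snd ?_ Prod.mk (fun _ _ => rfl) (fun _ _ => rfl)
  let := linearOrderOfSTO prec
  exact ⟨fun x y h1 h2 => Prod.ext h1 h2, fun _ _ => Iff.rfl, fun _ _ => Iff.rfl,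
    fun _ _ => Iff.rfl⟩
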